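/- **Theorem 4.1.** Consider states $$\tilde{\mathbf w}=(\rho,u_1,u_2,u_3,\theta_{11},\theta_{22},\theta_{33},\theta_{12},\theta_{13},\theta_{23},s_1,s_2,s_3)^T\in\mathbb R^{13}$$ with $\rho>0$ and $\boldsymbol\Theta=(\theta_{ij})_{3\times3}$ (with $\theta_{ij}=\theta_{ji}$) positive definite; write $\mathbf s=(s_1,s_2,s_3)^T$ and $\boldsymbol\Theta^{-1}=(\theta^{ij})$. Repeated indices are summed over $1,2,3$, $\frac{\mathrm d}{\mathrm dt}=\frac{\partial}{\partial t}+u_l\frac{\partial}{\partial x_l}$, and parentheses around indices denote symmetrization (the average over all permutations of the indices involved), e.g. $T_{(ij)}=\frac12(T_{ij}+T_{ji})$. Put $$D_{ijk;l}=s_{(i}\frac{\partial\theta_{jk)}}{\partial x_l}+\theta_{(ij}\frac{\partial s_{k)}}{\partial x_l}=\frac{\partial}{\partial x_l}\bigl(s_{(i}\theta_{jk)}\bigr),$$ where only $i,j,k$ are symmetrized. The modified 13-moment system is $$\frac{\mathrm d\rho}{\mathrm dt}+\rho\frac{\partial u_l}{\partial x_l}=0,\qquad \frac{\mathrm du_i}{\mathrm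 dt}+\frac{\theta_{il}}{\rho}\frac{\partial\rho}{\partial x_l}+\frac{\partial\theta_{il}}{\partial x_l}=0,$$ $$\frac{\mathrm d\theta_{ij}}{\mathrm dt}+2\theta_{l(i}\frac{\partial u_{j)}}{\partial x_l}+\frac{6}{5\rho}D_{ijl;l}=R_{ij},$$ $$\begin{aligned}\frac{\mathrm ds_j}{\mathrm dt}&-\frac65\theta^{ik}A_{ijk}-\frac{18}{25\rho}\theta^{ik}B_{ijk} +\frac12\Bigl(\rho\,\theta^{ik}\theta_{jl}\frac{\partial\theta_{ik}}{\partial x_l}+2\rho\frac{\partial\theta_{jl}}{\partial x_l}\Bigr)\\ &+\frac25\Bigl(\frac72\Bigl(s_j\frac{\partial u_l}{\partial x_l}+s_l\frac{\partial u_j}{\partial x_l}\Bigr)+\theta^{ik}\theta_{jl}s_{(i}\frac{\partial u_{k)}}{\partial x_l}\Bigr)=\tilde Q_j,\end{aligned}$$ where $A_{ijk}$ and $B_{ijk}$ are the symmetrizations over $(i,j,k)$ of $\theta_{li}\,s_j\,\frac{\partial u_k}{\partial x_l}$ and of $s_i\,D_{jkl;l}$ respectively (in both, $l$ is summed), and the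 right-hand sides $R_{ij}$, $\tilde Q_j$ contain no derivatives of $\tilde{\mathbf w}$. Written in the quasi-linear form $$\frac{\partial\tilde{\mathbf w}}{\partial t}+\sum_{k=1}^3\tilde{\mathbf M}_k(\tilde{\mathbf w})\frac{\partial\tilde{\mathbf w}}{\partial x_k}=\tilde{\mathbf Q}(\tilde{\mathbf w}),$$ this system defines the $13\times13$ coefficient matrices $\tilde{\mathbf M}_k(\tilde{\mathbf w})$. There exists a constant $\delta>0$ such that, for every state $\tilde{\mathbf w}$ with $\rho>0$ and $\boldsymbol\Theta$ positive definite, if $$\rho^{-2}\,\mathbf s^T\boldsymbol\Theta^{-1}\mathbf s<\delta,$$ then $\tilde{\mathbf M}_1(\tilde{\mathbf w})$ is real diagonalizable, i.e. $\tilde{\mathbf M}_1(\tilde{\mathbf w})=\mathbf P\mathbf D\mathbf P^{-1}$ with a real invertible matrix $\mathbf P$ and a real diagonal matrix $\mathbf D$. -/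

import Mathlib

open scoped Matrix

noncomputable section

namespace Moment13

/-- Density `ρ` of a state `w = (ρ, u₁, u₂, u₃, θ₁₁, θ₂₂, θ₃₃, θ₁₂, θ₁₃, θ₂₃, s₁, s₂, s₃)`. This and
the three maps below are linear in `w`, and are also used to name the components of a derivative
of `w`. -/
def rho (w : Fin 13 → ℝ) : ℝ := w 0

/-- Velocity `u` of a state. -/
def vel (w : Fin 13 → ℝ) : Fin 3 → ℝ := ![w 1, w 2, w 3]

/-- The symmetric temperature tensor `Θ = (θᵢⱼ)` of a state. -/
def temp (w : Fin 13 → ℝ) : Matrix (Fin 3) (Fin 3) ℝ :=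
  !![w 4, w 7, w 8;
     w 7, w 5, w 9;
     w 8, w 9, w 6]

/-- The vector `s` of a state. -/
def heat (w : Fin 13 → ℝ) : Fin 3 → ℝ := ![w 10, w 11, w 12]

/-- Symmetrization `T₍ᵢⱼ₎` of a 2-tensor. -/
def sym2 (T : Fin 3 → Fin 3 → ℝ) (i j : Fin 3) : ℝ := (T i j + T j i) / 2

/-- Symmetrization `T₍ᵢⱼₖ₎` of a 3-tensor. -/
def sym3 (T : Fin 3 → Fin 3 → Fin 3 → ℝ) (i j k : Fin 3) : ℝ :=
  (T i j k + T i k j + T j i k + T j k i + T k i j + T k j i) / 6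

/-- With `v = ∂w/∂xₗ`, this is
`s₍ᵢ ∂θⱼₖ₎/∂xₗ + θ₍ᵢⱼ ∂sₖ₎/∂xₗ = ∂(s₍ᵢ θⱼₖ₎)/∂xₗ`. -/
def dThird (w v : Fin 13 → ℝ) (i j k : Fin 3) : ℝ :=
  sym3 (fun a b c => heat w a * temp v b c) i j k +
    sym3 (fun a b c => temp w a b * heat v c) i j k

/-- The `∂/∂xₗ` terms in the equation for `ρ`, where `v = ∂w/∂xₗ`. -/
def rhoTerms (l : Fin 3) (w v : Fin 13 → ℝ) : ℝ :=
  vel w l * rho v + rho w * vel v l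

/-- The `∂/∂xₗ` terms in the equation for `uᵢ`, where `v = ∂w/∂xₗ`. -/
def velTerms (l : Fin 3) (w v : Fin 13 → ℝ) (i : Fin 3) : ℝ :=
  vel w l * vel v i + temp w i l / rho w * rho v + temp v i l

/-- The `∂/∂xₗ` terms in the equation for `θᵢⱼ`, where `v = ∂w/∂xₗ`. -/
def tempTerms (l : Fin 3) (w v : Fin 13 → ℝ) (i j : Fin 3) : ℝ :=
  vel w l * temp v i j +
    2 * sym2 (fun a b => temp w l a * vel v b) i j +
    6 / (5 * rho w) * dThird w v i j l

/-- The `∂/∂xₗ` terms in the equation for `sⱼ`, where `v = ∂w/∂xₗ`;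
`(temp w)⁻¹ i k` is `θ^{ik}`. -/
def heatTerms (l : Fin 3) (w v : Fin 13 → ℝ) (j : Fin 3) : ℝ :=
  vel w l * heat v j -
    6 / 5 * ∑ i, ∑ k, (temp w)⁻¹ i k *
      sym3 (fun a b c => temp w l a * heat w b * vel v c) i j k -
    18 / (25 * rho w) * ∑ i, ∑ k, (temp w)⁻¹ i k *
      sym3 (fun a b c => heat w a * dThird w v b c l) i j k +
    1 / 2 * ((∑ i, ∑ k, rho w * (temp w)⁻¹ i k * temp w j l * temp v i k) +
      2 * rho w * temp v j l) +
    2 / 5 * (7 * sym2 (fun a b => heat w a * vel v b) j l +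
      ∑ i, ∑ k, (temp w)⁻¹ i k * temp w j l *
        sym2 (fun a b => heat w a * vel v b) i k)

/-- All `∂/∂xₗ` terms of the modified 13-moment system, where `v = ∂w/∂xₗ`: the system is
`∂w/∂t + ∑ₗ spatialTerms l w (∂w/∂xₗ) = Q(w)`. -/
def spatialTerms (l : Fin 3) (w v : Fin 13 → ℝ) : Fin 13 → ℝ :=
  ![rhoTerms l w v,
    velTerms l w v 0, velTerms l w v 1, velTerms l w v 2,
    tempTerms l w v 0 0, tempTerms l w v 1 1, tempTerms l w v 2 2,
    tempTerms l w v 0 1, tempTerms l w v 0 2, tempTerms l w v 1 2,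
    heatTerms l w v 0, heatTerms l w v 1, heatTerms l w v 2]

/-- The coefficient matrix of `∂w/∂xₗ` in the quasi-linear form
`∂w/∂t + ∑ₗ coeffMatrix l w * ∂w/∂xₗ = Q(w)`; the first one has `l = 0`. -/
def coeffMatrix (l : Fin 3) (w : Fin 13 → ℝ) : Matrix (Fin 13) (Fin 13) ℝ :=
  Matrix.of fun a b => spatialTerms l w (Pi.single b 1) a

/-- The quasi-linear form: the spatial terms are the coefficient matrix applied to `∂w/∂xₗ`. -/
theorem spatialTerms_eq_mulVec (l : Fin 3) (w v : Fin 13 → ℝ) :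
    spatialTerms l w v = coeffMatrix l w *ᵥ v := by
  have hrho : ∀ x y : Fin 13 → ℝ, rho (x + y) = rho x + rho y := fun x y => rfl
  have hrho' : ∀ (c : ℝ) (x : Fin 13 → ℝ), rho (c • x) = c * rho x := fun c x => rfl
  have hvel : ∀ (x y : Fin 13 → ℝ) i, vel (x + y) i = vel x i + vel y i := by
    intro x y i; fin_cases i <;> rfl
  have hvel' : ∀ (c : ℝ) (x : Fin 13 → ℝ) i, vel (c • x) i = c * vel x i := by
    intro c x i; fin_cases i <;> rfl
  have hheat : ∀ (x y : Fin 13 → ℝ) i, heat (x + y) i = heat x i + heat y i := by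
    intro x y i; fin_cases i <;> rfl
  have hheat' : ∀ (c : ℝ) (x : Fin 13 → ℝ) i, heat (c • x) i = c * heat x i := by
    intro c x i; fin_cases i <;> rfl
  have htemp : ∀ (x y : Fin 13 → ℝ) i j, temp (x + y) i j = temp x i j + temp y i j := by
    intro x y i j; fin_cases i <;> fin_cases j <;> rfl
  have htemp' : ∀ (c : ℝ) (x : Fin 13 → ℝ) i j, temp (c • x) i j = c * temp x i j := by
    intro c x i j; fin_cases i <;> fin_cases j <;> rfl
  have hrT : ∀ x y, rhoTerms l w (x + y) = rhoTerms l w x + rhoTerms l w y := by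
    intro x y; simp only [rhoTerms, hrho, hvel]; ring
  have hrT' : ∀ (c : ℝ) x, rhoTerms l w (c • x) = c * rhoTerms l w x := by
    intro c x; simp only [rhoTerms, hrho', hvel']; ring
  have hvT : ∀ x y i, velTerms l w (x + y) i = velTerms l w x i + velTerms l w y i := by
    intro x y i; simp only [velTerms, hrho, hvel, htemp]; ring
  have hvT' : ∀ (c : ℝ) x i, velTerms l w (c • x) i = c * velTerms l w x i := by
    intro c x i; simp only [velTerms, hrho', hvel', htemp']; ring
  have hD : ∀ x y i j k, dThird w (x + y) i j k = dThird w x i j k + dThird w y i j k := by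
    intro x y i j k; simp only [dThird, sym3, hheat, htemp]; ring
  have hD' : ∀ (c : ℝ) x i j k, dThird w (c • x) i j k = c * dThird w x i j k := by
    intro c x i j k; simp only [dThird, sym3, hheat', htemp']; ring
  have htT : ∀ x y i j, tempTerms l w (x + y) i j =
      tempTerms l w x i j + tempTerms l w y i j := by
    intro x y i j; simp only [tempTerms, sym2, hvel, htemp, hD]; ring
  have htT' : ∀ (c : ℝ) x i j, tempTerms l w (c • x) i j = c * tempTerms l w x i j := by
    intro c x i j; simp only [tempTerms, sym2, hvel', htemp', hD']; ring
  have hhT : ∀ x y j, heatTerms l w (x + y) j = heatTerms l w x j + heatTerms l w y j := by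
    intro x y j
    simp only [heatTerms, sym2, sym3, hvel, htemp, hheat, hD, Fin.sum_univ_three]; ring
  have hhT' : ∀ (c : ℝ) x j, heatTerms l w (c • x) j = c * heatTerms l w x j := by
    intro c x j
    simp only [heatTerms, sym2, sym3, hvel', htemp', hheat', hD', Fin.sum_univ_three]; ring
  let L : (Fin 13 → ℝ) →ₗ[ℝ] (Fin 13 → ℝ) :=
    { toFun := spatialTerms l w
      map_add' := by
        intro x y
        simp only [spatialTerms, hrT, hvT, htT, hhT]
        ext a; fin_cases a <;> rfl
      map_smul' := by
        intro c x
        simp only [spatialTerms, hrT', hvT', htT', hhT']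
        ext a; fin_cases a <;> rfl }
  have hM : coeffMatrix l w = LinearMap.toMatrix' L := by
    ext a b
    simp only [LinearMap.toMatrix'_apply, coeffMatrix, Matrix.of_apply]
    congr 2
  rw [hM, LinearMap.toMatrix'_mulVec]
  rfl

/-- A real square matrix is real diagonalizable if it is similar over `ℝ` to a diagonal matrix. -/
def RealDiagonalizable {n : ℕ} (A : Matrix (Fin n) (Fin n) ℝ) : Prop :=
  ∃ (P : Matrix (Fin n) (Fin n) ℝ) (d : Fin n → ℝ),
    IsUnit P ∧ A = P * Matrix.diagonal d * P⁻¹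

end Moment13

end

noncomputable section

namespace Moment13

open Filter Topology

/-! The system is equivariant under scaling `(ρ, s)` and under linear changes of frame. Factor `Θ =
L Lᵀ` with the first row of `L` a multiple of `e₁`, and write `s = ρ L (a, b, 0)` with `a ≥ 0`. The
change of frame given by `ρ` and `L` then turns the matrix at `w` into an affine function of the
matrix at `ρ = 1, u = 0, Θ = 1, s = (a, b, 0)` (`spatialTerms_changeFrame`, `exists_frame`). The
smallness quantity is exactly `a² + b²`, so only small `(a, b)` has to be treated.

There `s₃ = 0`, and the reflection `x₃ ↦ -x₃` splits the matrix into blocks of size 9 and 4. At `a =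
b = 0` they have six and two simple nonzero real eigenvalues, which persist by sign changes of the
characteristic polynomials. The difficulty is the eigenvalue zero, of multiplicity three and two. If
`a = 0`, its eigenspace still has full dimension, as explicit kernel vectors show. If `a > 0`, the
substitution `l = a z` and division by a power of `a` give a polynomial with a limit as `(a, b) →
0`, whose roots are `-2/5, 2/5, 2/5` for the large block and `-2/5, 2/5` for the small one. The
double root could become complex. It does not, because the rescaled polynomial at `z = 2/5` is a
positive multiple of `a² b²` (`evenCharScaled_two_fifths`); for `b = 0` the value `2/5` is an exact
eigenvalue and another root lies strictly below it. Hence each block has distinct real eigenvalues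
when `a > 0`. -/

/-- An endomorphism is diagonalizable if its eigenspaces span the whole space. -/
def Diagonalizable {V : Type*} [AddCommGroup V] [Module ℝ V] (f : Module.End ℝ V) : Prop :=
  ⨆ μ, f.eigenspace μ = ⊤

/-! ### Criteria for diagonalizability -/

section Diagonalizable

variable {V W : Type*} [AddCommGroup V] [Module ℝ V] [AddCommGroup W] [Module ℝ W]

/-- A linear map `T` with `g ∘ T = T ∘ (c f + d)` maps eigenvectors of `f` to eigenvectors of
`g`. -/
theorem map_iSup_eigenspace_le {f : Module.End ℝ V} {g : Module.End ℝ W} (T : V →ₗ[ℝ] W)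
    (c d : ℝ) (h : ∀ v, g (T v) = T (c • f v + d • v)) :
    (⨆ μ, f.eigenspace μ).map T ≤ ⨆ μ, g.eigenspace μ := by
  rw [Submodule.map_iSup]
  refine iSup_le fun μ => ?_
  refine le_trans ?_ (le_iSup _ (c * μ + d))
  rintro _ ⟨v, hv, rfl⟩
  have hv' : f v = μ • v := Module.End.mem_eigenspace_iff.1 hv
  rw [Module.End.mem_eigenspace_iff, h, hv', ← map_smul]
  congr 1
  module

/-- The affine function absorbs the two effects of a change of frame on the matrix: a rescaling of
the `x₁` direction and a Galilean shift by `u₁`. -/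
theorem Diagonalizable.of_surjective {f : Module.End ℝ V} {g : Module.End ℝ W}
    (hf : Diagonalizable f) (T : V →ₗ[ℝ] W) (hT : Function.Surjective T)
    (c d : ℝ) (h : ∀ v, g (T v) = T (c • f v + d • v)) : Diagonalizable g := by
  have := map_iSup_eigenspace_le T c d h
  rw [show (⨆ μ, f.eigenspace μ) = ⊤ from hf, Submodule.map_top,
    LinearMap.range_eq_top.2 hT] at this
  exact top_le_iff.1 this

theorem Diagonalizable.of_coprod {U : Type*} [AddCommGroup U] [Module ℝ U]
    {f : Module.End ℝ V} {g : Module.End ℝ W} {k : Module.End ℝ U}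
    (hf : Diagonalizable f) (hg : Diagonalizable g) (S : V →ₗ[ℝ] U) (T : W →ₗ[ℝ] U)
    (hS : ∀ v, k (S v) = S (f v)) (hT : ∀ v, k (T v) = T (g v))
    (hST : ∀ x, ∃ v w, x = S v + T w) : Diagonalizable k := by
  have h1 := map_iSup_eigenspace_le S 1 0 (f := f) (g := k) (by intro v; simp [hS])
  have h2 := map_iSup_eigenspace_le T 1 0 (f := g) (g := k) (by intro v; simp [hT])
  rw [show (⨆ μ, f.eigenspace μ) = ⊤ from hf] at h1
  rw [show (⨆ μ, g.eigenspace μ) = ⊤ from hg] at h2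
  refine top_le_iff.1 fun x _ => ?_
  obtain ⟨v, w, rfl⟩ := hST x
  exact add_mem (h1 ⟨v, trivial, rfl⟩) (h2 ⟨w, trivial, rfl⟩)

theorem linearIndependent_of_injective_eigenvalues {n : ℕ} {f : Module.End ℝ V} {l : Fin n → ℝ}
    (hl : Function.Injective l) {v : Fin n → V} (hv : ∀ i, v i ≠ 0 ∧ f (v i) = l i • v i) :
    LinearIndependent ℝ v :=
  Module.End.eigenvectors_linearIndependent' f l hl v fun i =>
    ⟨Module.End.mem_eigenspace_iff.2 (hv i).2, (hv i).1⟩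

theorem Diagonalizable.of_injective [FiniteDimensional ℝ V] {n : ℕ} {f : Module.End ℝ V}
    (hn : Module.finrank ℝ V = n) {l : Fin n → ℝ} (hl : Function.Injective l)
    (h : ∀ i, ∃ v, v ≠ 0 ∧ f v = l i • v) : Diagonalizable f := by
  choose v hv using h
  have hi := linearIndependent_of_injective_eigenvalues hl hv
  have hs := hi.span_eq_top_of_card_eq_finrank' (by simp [hn])
  refine top_le_iff.1 (hs ▸ Submodule.span_le.2 ?_)
  rintro _ ⟨i, rfl⟩
  exact (le_iSup (fun μ => f.eigenspace μ) (l i)) (Module.End.mem_eigenspace_iff.2 (hv i).2)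

/-- Diagonalizability from distinct nonzero eigenvalues and independent kernel vectors. -/
theorem Diagonalizable.of_injective_of_kernel [FiniteDimensional ℝ V] {m n : ℕ}
    {f : Module.End ℝ V} (hn : Module.finrank ℝ V = m + n) {l : Fin m → ℝ}
    (hl : Function.Injective l) (hl0 : ∀ i, l i ≠ 0) (h : ∀ i, ∃ v, v ≠ 0 ∧ f v = l i • v)
    {k : Fin n → V} (hk : LinearIndependent ℝ k) (hk0 : ∀ i, f (k i) = 0) :
    Diagonalizable f := by
  choose v hv using h
  have hi := linearIndependent_of_injective_eigenvalues hl hv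
  have hS : Submodule.span ℝ (Set.range v) ≤ ⨆ μ ≠ (0 : ℝ), f.eigenspace μ := by
    refine Submodule.span_le.2 ?_
    rintro _ ⟨i, rfl⟩
    exact (le_iSup₂ (f := fun μ (_ : μ ≠ (0 : ℝ)) => f.eigenspace μ) (l i) (hl0 i))
      (Module.End.mem_eigenspace_iff.2 (hv i).2)
  have hK : Submodule.span ℝ (Set.range k) ≤ f.eigenspace 0 := by
    refine Submodule.span_le.2 ?_
    rintro _ ⟨i, rfl⟩
    exact Module.End.mem_eigenspace_iff.2 (by simp [hk0])
  have hd : Disjoint (Submodule.span ℝ (Set.range k)) (Submodule.span ℝ (Set.range v)) :=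
    (f.eigenspaces_iSupIndep 0).mono hK hS
  have hr := Submodule.finrank_sup_add_finrank_inf_eq
    (Submodule.span ℝ (Set.range k)) (Submodule.span ℝ (Set.range v))
  rw [disjoint_iff.1 hd, finrank_span_eq_card hk, finrank_span_eq_card hi] at hr
  simp only [finrank_bot, Fintype.card_fin, add_zero] at hr
  have ht : Submodule.span ℝ (Set.range k) ⊔ Submodule.span ℝ (Set.range v) = ⊤ :=
    Submodule.eq_top_of_finrank_eq (by omega)
  refine top_le_iff.1 (ht ▸ sup_le (hK.trans (le_iSup (fun μ => f.eigenspace μ) 0)) (hS.trans ?_))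
  exact iSup₂_le fun μ _ => le_iSup (fun μ => f.eigenspace μ) μ

theorem Diagonalizable.realDiagonalizable {n : ℕ} {A : Matrix (Fin n) (Fin n) ℝ}
    (h : Diagonalizable A.mulVecLin) : RealDiagonalizable A := by
  let E : Set (Fin n → ℝ) := {v | ∃ μ : ℝ, A *ᵥ v = μ • v}
  have hE : Submodule.span ℝ E = ⊤ := by
    refine top_le_iff.1 (h ▸ iSup_le fun μ v hv => Submodule.subset_span ⟨μ, ?_⟩)
    simpa using Module.End.mem_eigenspace_iff.1 hv
  obtain ⟨b, hbE, hbs, hbi⟩ := exists_linearIndependent ℝ E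
  let B : Module.Basis b ℝ (Fin n → ℝ) :=
    Module.Basis.mk hbi (by rw [Subtype.range_coe, hbs, hE])
  have : Fintype b := FiniteDimensional.fintypeBasisIndex B
  have hc : Fintype.card b = n := by
    simpa using (Module.finrank_eq_card_basis B).symm
  let C := B.reindex (Fintype.equivFinOfCardEq hc)
  have hC : ∀ i, ∃ μ : ℝ, A *ᵥ C i = μ • C i := by
    intro i
    have : C i ∈ E := by
      simp only [C, B, Module.Basis.reindex_apply, Module.Basis.mk_apply]
      exact hbE (Subtype.coe_prop _)
    exact this
  choose d hd using hC
  let P : Matrix (Fin n) (Fin n) ℝ := Matrix.of fun i j => C j i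
  have hP : IsUnit P := by
    rw [← Matrix.isUnit_transpose, ← Matrix.linearIndependent_rows_iff_isUnit]
    exact C.linearIndependent
  refine ⟨P, d, hP, ?_⟩
  have hAP : A * P = P * Matrix.diagonal d := by
    ext i j
    have := congrFun (hd j) i
    rw [Matrix.mul_diagonal]
    simp only [Matrix.mulVec, dotProduct, Pi.smul_apply, smul_eq_mul] at this
    simp only [Matrix.mul_apply, P, Matrix.of_apply, this, mul_comm]
  rw [← hAP, Matrix.mul_nonsing_inv_cancel_right _ _ ((Matrix.isUnit_iff_isUnit_det _).1 hP)]

end Diagonalizable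

/-! ### Roots from sign changes -/

theorem exists_root_of_pos_neg {p : ℝ → ℝ} (hp : Continuous p) {x y : ℝ} (hxy : x < y)
    (hx : 0 < p x) (hy : p y < 0) : ∃ z, x < z ∧ z < y ∧ p z = 0 := by
  obtain ⟨z, hz, h⟩ := intermediate_value_Ioo' hxy.le hp.continuousOn ⟨hy, hx⟩
  exact ⟨z, hz.1, hz.2, h⟩

theorem exists_root_of_neg_pos {p : ℝ → ℝ} (hp : Continuous p) {x y : ℝ} (hxy : x < y)
    (hx : p x < 0) (hy : 0 < p y) : ∃ z, x < z ∧ z < y ∧ p z = 0 := by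
  obtain ⟨z, hz, h⟩ := intermediate_value_Ioo hxy.le hp.continuousOn ⟨hx, hy⟩
  exact ⟨z, hz.1, hz.2, h⟩

theorem eventually_pos_of_pos {F : ℝ × ℝ → ℝ} (hF : Continuous F) (h : 0 < F 0) :
    ∀ᶠ s in 𝓝 (0 : ℝ × ℝ), 0 < F s :=
  hF.continuousAt.eventually (lt_mem_nhds h)

theorem eventually_neg_of_neg {F : ℝ × ℝ → ℝ} (hF : Continuous F) (h : F 0 < 0) :
    ∀ᶠ s in 𝓝 (0 : ℝ × ℝ), F s < 0 :=
  hF.continuousAt.eventually (gt_mem_nhds h)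

/-! ### The odd block -/

/-- The block of the coefficient matrix at `ρ = 1`, `u = 0`, `Θ = 1`, `s = (a, b, 0)` acting on
the components `(u₃, θ₁₃, θ₂₃, s₃)`. -/
def oddBlock (a b : ℝ) : Matrix (Fin 4) (Fin 4) ℝ :=
  !![0, 1, 0, 0;
     1, 4 / 5 * a, 0, 2 / 5;
     0, 2 / 5 * b, 2 / 5 * a, 0;
     a, 1 - 4 / 25 * b ^ 2 - 8 / 25 * a ^ 2, -(4 / 25 * a * b), -(4 / 25 * a)]

/-- A multiple of the characteristic polynomial of `oddBlock a b`. -/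
def oddChar (a b l : ℝ) : ℝ :=
  (a + (1 - 4 / 25 * b ^ 2 - 8 / 25 * a ^ 2) * l) * (l - 2 / 5 * a) - 8 / 125 * a * b ^ 2 * l
    - (4 / 25 * a + l) * (5 / 2) * (l ^ 2 - 4 / 5 * a * l - 1) * (l - 2 / 5 * a)

/-- `oddChar a b (a * z) / a ^ 2`. -/
def oddCharScaled (a b z : ℝ) : ℝ :=
  (1 + (1 - 4 / 25 * b ^ 2 - 8 / 25 * a ^ 2) * z) * (z - 2 / 5) - 8 / 125 * b ^ 2 * z
    - (4 / 25 + z) * (5 / 2) * (a ^ 2 * z ^ 2 - 4 / 5 * a ^ 2 * z - 1) * (z - 2 / 5)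

theorem oddChar_mul (a b z : ℝ) : oddChar a b (a * z) = a ^ 2 * oddCharScaled a b z := by
  unfold oddChar oddCharScaled; ring

theorem oddBlock_exists_eigenvector {a b l : ℝ} (hl : l ≠ 2 / 5 * a) (h : oddChar a b l = 0) :
    ∃ v, v ≠ 0 ∧ (oddBlock a b).mulVecLin v = l • v := by
  -- The first three rows are solved successively for `θ₁₃`, `θ₂₃` and `s₃` in terms of `u₃ = l -
  -- 2/5 a`, a choice that clears the denominator in `θ₂₃`. The last row is then `oddChar a b l =
  -- 0`.
  refine ⟨![l - 2 / 5 * a, l * (l - 2 / 5 * a), 2 / 5 * b * l,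
    5 / 2 * (l ^ 2 - 4 / 5 * a * l - 1) * (l - 2 / 5 * a)], ?_, ?_⟩
  · intro h0
    exact hl (sub_eq_zero.1 (congrFun h0 0))
  · unfold oddChar at h
    ext i
    fin_cases i <;>
      simp [oddBlock, Matrix.mulVec, dotProduct, Fin.sum_univ_succ] <;>
      linarith [h]

/-- For `b = 0` the component `θ₂₃` decouples. This supplies the eigenvalue `2/5 a` that the general
eigenvector formula excludes. -/
theorem oddBlock_exists_eigenvector_of_eq_zero (a : ℝ) :
    ∃ v, v ≠ 0 ∧ (oddBlock a 0).mulVecLin v = (a * (2 / 5)) • v := by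
  refine ⟨![0, 0, 1, 0], fun h0 => by simpa using congrFun h0 2, ?_⟩
  ext i
  fin_cases i <;> simp [oddBlock, Matrix.mulVec, dotProduct, Fin.sum_univ_succ, mul_comm]

theorem continuous_oddChar (a b : ℝ) : Continuous (oddChar a b) := by
  unfold oddChar; fun_prop

theorem continuous_oddCharScaled (a b : ℝ) : Continuous (oddCharScaled a b) := by
  unfold oddCharScaled; fun_prop

theorem eventually_diagonalizable_oddBlock :
    ∀ᶠ s in 𝓝 (0 : ℝ × ℝ), 0 ≤ s.1 → Diagonalizable (oddBlock s.1 s.2).mulVecLin := by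
  have hc : ∀ l, Continuous fun s : ℝ × ℝ => oddChar s.1 s.2 l := by
    intro l; unfold oddChar; fun_prop
  have hcs : ∀ z, Continuous fun s : ℝ × ℝ => oddCharScaled s.1 s.2 z := by
    intro l; unfold oddCharScaled; fun_prop
  -- At `a = b = 0` the nonzero roots are `±√(7/5)`, between `1` and `3/2` in absolute value, and
  -- the rescaled roots are `±2/5`. The bound `a < 1` separates the two groups.
  filter_upwards [eventually_neg_of_neg (hc (-(3 / 2))) (by norm_num [oddChar]),
    eventually_pos_of_pos (hc (-1)) (by norm_num [oddChar]),
    eventually_pos_of_pos (hc 1) (by norm_num [oddChar]),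
    eventually_neg_of_neg (hc (3 / 2)) (by norm_num [oddChar]),
    eventually_pos_of_pos (hcs (-1)) (by norm_num [oddCharScaled]),
    eventually_neg_of_neg (hcs 0) (by norm_num [oddCharScaled]),
    eventually_pos_of_pos (hcs 1) (by norm_num [oddCharScaled]),
    eventually_neg_of_neg (F := fun s : ℝ × ℝ => s.1 - 1) (by fun_prop) (by norm_num)]
  rintro ⟨a, b⟩ h1 h2 h3 h4 h5 h6 h7 h8 ha
  simp only at h1 h2 h3 h4 h5 h6 h7 h8 ha ⊢
  obtain ⟨x, hx1, hx2, hx⟩ :=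
    exists_root_of_neg_pos (continuous_oddChar a b) (by norm_num) h1 h2
  obtain ⟨y, hy1, hy2, hy⟩ :=
    exists_root_of_pos_neg (continuous_oddChar a b) (by norm_num) h3 h4
  have hxv := oddBlock_exists_eigenvector (by linarith) hx
  have hyv := oddBlock_exists_eigenvector (by linarith) hy
  rcases ha.eq_or_lt with rfl | ha
  · refine Diagonalizable.of_injective_of_kernel (m := 2) (n := 2) (l := ![x, y])
      (k := ![![2, 0, 0, -5], ![0, 0, 1, 0]]) (by simp) ?_ ?_ ?_ ?_ ?_
    · refine (Fin.strictMono_iff_lt_succ.2 ?_).injective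
      intro i; fin_cases i; simp; linarith
    · intro i; fin_cases i <;> simp <;> intro h <;> linarith
    · intro i; fin_cases i; exacts [hxv, hyv]
    · rw [LinearIndependent.pair_iff]
      intro s t h
      exact ⟨by simpa using congrFun h 0, by simpa using congrFun h 2⟩
    · intro i
      fin_cases i <;> ext j <;> fin_cases j <;>
        norm_num [oddBlock, Matrix.mulVec, dotProduct, Fin.sum_univ_succ]
  · obtain ⟨z, hz1, hz2, hz⟩ :=
      exists_root_of_pos_neg (continuous_oddCharScaled a b) (by norm_num) h5 h6
    have hzv : ∃ v, v ≠ 0 ∧ (oddBlock a b).mulVecLin v = (a * z) • v :=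
      oddBlock_exists_eigenvector (by nlinarith) (by rw [oddChar_mul, hz, mul_zero])
    obtain ⟨t, ht1, ht2, htv⟩ : ∃ t, 2 / 5 ≤ t ∧ t < 1 ∧
        ∃ v, v ≠ 0 ∧ (oddBlock a b).mulVecLin v = (a * t) • v := by
      -- For `b ≠ 0` the rescaled polynomial is strictly negative at `2/5`, so its root lies
      -- strictly above this excluded value.
      rcases eq_or_ne b 0 with rfl | hb
      · exact ⟨2 / 5, le_rfl, by norm_num, oddBlock_exists_eigenvector_of_eq_zero a⟩
      · have hs : oddCharScaled a b (2 / 5) < 0 := by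
          have : 0 < b ^ 2 := by positivity
          unfold oddCharScaled; linarith
        obtain ⟨t, ht1, ht2, ht⟩ :=
          exists_root_of_neg_pos (continuous_oddCharScaled a b) (by norm_num) hs h7
        exact ⟨t, ht1.le, ht2,
          oddBlock_exists_eigenvector (by nlinarith) (by rw [oddChar_mul, ht, mul_zero])⟩
    refine Diagonalizable.of_injective (n := 4) (l := ![x, a * z, a * t, y]) (by simp) ?_ ?_
    · refine (Fin.strictMono_iff_lt_succ.2 ?_).injective
      intro i; fin_cases i <;> simp <;> nlinarith
    · intro i; fin_cases i; exacts [hxv, hzv, htv, hyv]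

/-! ### The even block -/

/-- The block of the coefficient matrix at `ρ = 1`, `u = 0`, `Θ = 1`, `s = (a, b, 0)` acting on
the components `(ρ, u₁, u₂, θ₁₁, θ₂₂, θ₃₃, θ₁₂, s₁, s₂)`. -/
def evenBlock (a b : ℝ) : Matrix (Fin 9) (Fin 9) ℝ :=
  !![0, 1, 0, 0, 0, 0, 0, 0, 0;
     1, 0, 0, 1, 0, 0, 0, 0, 0;
     0, 0, 0, 0, 0, 0, 1, 0, 0;
     0, 2, 0, 6 / 5 * a, 0, 0, 0, 6 / 5, 0;
     0, 0, 0, 0, 2 / 5 * a, 0, 4 / 5 * b, 2 / 5, 0;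
     0, 0, 0, 0, 0, 2 / 5 * a, 0, 2 / 5, 0;
     0, 0, 1, 2 / 5 * b, 0, 0, 4 / 5 * a, 0, 2 / 5;
     0, 2 * a, 0, 3 / 2 - 4 / 25 * b ^ 2 - 18 / 25 * a ^ 2, 1 / 2 - 2 / 25 * a ^ 2,
       1 / 2 - 2 / 25 * a ^ 2, -(12 / 25 * a * b), -(22 / 25 * a), -(4 / 25 * b);
     0, b, a, -(2 / 5 * a * b), -(6 / 25 * a * b), -(2 / 25 * a * b),
       1 - 12 / 25 * b ^ 2 - 8 / 25 * a ^ 2, -(14 / 25 * b), -(4 / 25 * a)]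

/-- The ratio `s₁ / ρ` for an eigenvector of `evenBlock a b` with eigenvalue `l`. -/
def heatRatio (a l : ℝ) : ℝ := 5 / 6 * (l ^ 3 - 3 * l) - a * (l ^ 2 - 1)

/-- The system for `(ρ, u₂) / (l - 2 / 5 * a)` that remains of the eigenvector equations of
`evenBlock a b` after elimination of the other components. -/
def evenReduced (a b l : ℝ) : Matrix (Fin 2) (Fin 2) ℝ :=
  !![(2 * a * l + (3 / 2 - 4 / 25 * b ^ 2 - 18 / 25 * a ^ 2) * (l ^ 2 - 1)
        - (22 / 25 * a + l) * heatRatio a l + 4 / 25 * b ^ 2 * (l ^ 2 - 1)) * (l - 2 / 5 * a)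
        + (1 / 2 - 2 / 25 * a ^ 2) * (4 / 5) * heatRatio a l,
     (1 / 2 - 2 / 25 * a ^ 2) * (4 / 5) * b * l - (12 / 25 * a * b * l
        + 4 / 25 * b * (5 / 2) * (l ^ 2 - 1 - 4 / 5 * a * l)) * (l - 2 / 5 * a);
     (b * l - 2 / 5 * a * b * (l ^ 2 - 1) - 14 / 25 * b * heatRatio a l
        + (4 / 25 * a + l) * b * (l ^ 2 - 1)) * (l - 2 / 5 * a)
        - 16 / 125 * a * b * heatRatio a l,
     (a + (1 - 12 / 25 * b ^ 2 - 8 / 25 * a ^ 2) * l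
        - (4 / 25 * a + l) * (5 / 2) * (l ^ 2 - 1 - 4 / 5 * a * l)) * (l - 2 / 5 * a)
        - 24 / 125 * a * b ^ 2 * l]

/-- A multiple of the characteristic polynomial of `evenBlock a b`. -/
def evenChar (a b l : ℝ) : ℝ := (evenReduced a b l).det

/-- `heatRatio a (a * z) / a`. -/
def heatRatioScaled (a z : ℝ) : ℝ := 5 / 6 * (a ^ 2 * z ^ 3 - 3 * z) - (a ^ 2 * z ^ 2 - 1)

/-- The upper left entry of `evenReduced a b (a * z)`, divided by `a`. -/
def evenCorner (a b z : ℝ) : ℝ :=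
  (2 * a ^ 2 * z + (3 / 2 - 4 / 25 * b ^ 2 - 18 / 25 * a ^ 2) * (a ^ 2 * z ^ 2 - 1)
    - a ^ 2 * (22 / 25 + z) * heatRatioScaled a z + 4 / 25 * b ^ 2 * (a ^ 2 * z ^ 2 - 1))
      * (z - 2 / 5)
    + (1 / 2 - 2 / 25 * a ^ 2) * (4 / 5) * heatRatioScaled a z

/-- `evenChar a b (a * z) / a ^ 3`. -/
def evenCharScaled (a b z : ℝ) : ℝ :=
  evenCorner a b z *
    ((1 + (1 - 12 / 25 * b ^ 2 - 8 / 25 * a ^ 2) * z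
        - (4 / 25 + z) * (5 / 2) * (a ^ 2 * z ^ 2 - 1 - 4 / 5 * a ^ 2 * z)) * (z - 2 / 5)
        - 24 / 125 * b ^ 2 * z) -
  ((1 / 2 - 2 / 25 * a ^ 2) * (4 / 5) * b * z - (12 / 25 * a ^ 2 * b * z
        + 4 / 25 * b * (5 / 2) * (a ^ 2 * z ^ 2 - 1 - 4 / 5 * a ^ 2 * z)) * (z - 2 / 5)) *
    ((b * z - 2 / 5 * b * (a ^ 2 * z ^ 2 - 1) - 14 / 25 * b * heatRatioScaled a z
        + (4 / 25 + z) * b * (a ^ 2 * z ^ 2 - 1)) * (z - 2 / 5)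
        - 16 / 125 * b * heatRatioScaled a z)

theorem evenChar_mul (a b z : ℝ) : evenChar a b (a * z) = a ^ 3 * evenCharScaled a b z := by
  simp only [evenChar, evenReduced, Matrix.det_fin_two_of, evenCharScaled, evenCorner]
  have : heatRatio a (a * z) = a * heatRatioScaled a z := by
    unfold heatRatio heatRatioScaled; ring
  rw [this]
  ring

theorem evenBlock_exists_eigenvector {a b l : ℝ} (hl : l ≠ 2 / 5 * a) (h : evenChar a b l = 0) :
    ∃ v, v ≠ 0 ∧ (evenBlock a b).mulVecLin v = l • v := by
  obtain ⟨x, hx, h⟩ := Matrix.exists_mulVec_eq_zero_iff.2 h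
  have h0 := congrFun h 0
  have h1 := congrFun h 1
  obtain ⟨k, hk⟩ : ∃ k, k = l - 2 / 5 * a := ⟨_, rfl⟩
  have hk0 : k ≠ 0 := hk ▸ sub_ne_zero.2 hl
  have hlk : l = k + 2 / 5 * a := by linarith
  obtain ⟨S, hS⟩ : ∃ S, S = heatRatio a l := ⟨_, rfl⟩
  simp only [evenReduced, Matrix.mulVec, dotProduct, Fin.sum_univ_two, Matrix.of_apply,
    Matrix.cons_val_zero, Matrix.cons_val_one, Pi.zero_apply, ← hS, ← hk] at h0 h1
  unfold heatRatio at hS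
  -- With `ρ = k x₀` and `u₂ = k x₁`, every row except those of `s₁` and `s₂` determines one further
  -- component; the factor `k` clears the denominator in `θ₂₂` and `θ₃₃`. The two remaining rows are
  -- the reduced system `h0`, `h1`.
  refine ⟨![k * x 0, l * (k * x 0), k * x 1, (l ^ 2 - 1) * (k * x 0),
    2 / 5 * (S * x 0) + 4 / 5 * b * l * x 1, 2 / 5 * (S * x 0), l * (k * x 1), S * (k * x 0),
    5 / 2 * (l ^ 2 - 1 - 4 / 5 * a * l) * (k * x 1) - b * (l ^ 2 - 1) * (k * x 0)], ?_, ?_⟩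
  · intro hv
    apply hx
    ext i
    fin_cases i
    · simpa [hk0] using congrFun hv 0
    · simpa [hk0] using congrFun hv 2
  · ext i
    fin_cases i <;>
      simp [evenBlock, Matrix.mulVec, dotProduct, Fin.sum_univ_succ]
    · ring
    · rw [hS]; ring
    · rw [hlk]; ring
    · rw [hlk]; ring
    · ring
    · linear_combination h0
    · linear_combination h1

/-- For `b = 0` the columns of `θ₂₂` and `θ₃₃` differ only in their diagonal entries, so the
difference of these components is an eigenvector. -/
theorem evenBlock_exists_eigenvector_of_eq_zero (a : ℝ) :
    ∃ v, v ≠ 0 ∧ (evenBlock a 0).mulVecLin v = (a * (2 / 5)) • v := by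
  refine ⟨![0, 0, 0, 0, 1, -1, 0, 0, 0], fun h0 => by simpa using congrFun h0 4, ?_⟩
  ext i
  fin_cases i <;> simp [evenBlock, Matrix.mulVec, dotProduct, Fin.sum_univ_succ, mul_comm]

theorem continuous_evenChar (a b : ℝ) : Continuous (evenChar a b) := by
  unfold evenChar evenReduced heatRatio
  simp only [Matrix.det_fin_two_of]
  fun_prop

theorem continuous_evenCorner (a b : ℝ) : Continuous (evenCorner a b) := by
  unfold evenCorner heatRatioScaled; fun_prop

theorem continuous_evenCharScaled (a b : ℝ) : Continuous (evenCharScaled a b) := by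
  unfold evenCharScaled evenCorner heatRatioScaled; fun_prop

theorem heatRatioScaled_two_fifths (a : ℝ) : heatRatioScaled a (2 / 5) = -(8 / 75 * a ^ 2) := by
  unfold heatRatioScaled; ring

theorem evenCorner_two_fifths (a b : ℝ) :
    evenCorner a b (2 / 5) = -((1 / 2 - 2 / 25 * a ^ 2) * (32 / 375) * a ^ 2) := by
  unfold evenCorner; rw [heatRatioScaled_two_fifths]; ring

/-- At `a = b = 0` the rescaled polynomial has a double root at `2/5` and is negative at `0` and
`1`. A positive value at `2/5` therefore forces two real roots, one on each side. -/
theorem evenCharScaled_two_fifths (a b : ℝ) : evenCharScaled a b (2 / 5) =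
    (1 / 2 - 2 / 25 * a ^ 2) * (512 / 234375) * a ^ 2 * b ^ 2 := by
  unfold evenCharScaled
  rw [evenCorner_two_fifths, heatRatioScaled_two_fifths]; ring

/-- For `a > 0` the block has three distinct eigenvalues near zero. -/
theorem evenBlock_exists_small_eigenvalues {a b : ℝ} (ha : 0 < a) (ha1 : a < 1)
    (h1 : 0 < evenCharScaled a b (-1)) (h2 : evenCharScaled a b 0 < 0)
    (h3 : 0 < evenCorner a b 0) (h4 : evenCharScaled a b 1 < 0) :
    ∃ x y z : ℝ, -1 < x ∧ x < y ∧ y < z ∧ z < 1 ∧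
      (∃ v, v ≠ 0 ∧ (evenBlock a b).mulVecLin v = (a * x) • v) ∧
      (∃ v, v ≠ 0 ∧ (evenBlock a b).mulVecLin v = (a * y) • v) ∧
      (∃ v, v ≠ 0 ∧ (evenBlock a b).mulVecLin v = (a * z) • v) := by
  have hv : ∀ x, x ≠ 2 / 5 → evenCharScaled a b x = 0 →
      ∃ v, v ≠ 0 ∧ (evenBlock a b).mulVecLin v = (a * x) • v := by
    intro x hx h
    refine evenBlock_exists_eigenvector ?_ (by rw [evenChar_mul, h, mul_zero])
    rw [mul_comm]
    exact fun h => hx (mul_right_cancel₀ ha.ne' h)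
  obtain ⟨x, hx1, hx2, hx⟩ :=
    exists_root_of_pos_neg (continuous_evenCharScaled a b) (by norm_num) h1 h2
  have ha2 : 0 < 1 / 2 - 2 / 25 * a ^ 2 := by nlinarith
  -- For `b = 0` the reduced system is diagonal, so roots of `evenCorner` are roots of
  -- `evenCharScaled`. The corner changes sign strictly before `2/5`, so its root differs from the
  -- explicit eigenvalue there.
  rcases eq_or_ne b 0 with rfl | hb
  · have hs : evenCorner a 0 (2 / 5) < 0 := by
      rw [evenCorner_two_fifths, neg_lt_zero]; positivity
    obtain ⟨y, hy1, hy2, hy⟩ :=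
      exists_root_of_pos_neg (continuous_evenCorner a 0) (by norm_num) h3 hs
    exact ⟨x, y, 2 / 5, hx1, by linarith, hy2, by norm_num, hv x (by linarith) hx,
      hv y (by linarith) (by simp [evenCharScaled, hy]),
      evenBlock_exists_eigenvector_of_eq_zero a⟩
  · have hs : 0 < evenCharScaled a b (2 / 5) := by
      rw [evenCharScaled_two_fifths]; positivity
    obtain ⟨y, hy1, hy2, hy⟩ :=
      exists_root_of_neg_pos (continuous_evenCharScaled a b) (by norm_num) h2 hs
    obtain ⟨z, hz1, hz2, hz⟩ :=
      exists_root_of_pos_neg (continuous_evenCharScaled a b) (by norm_num) hs h4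
    exact ⟨x, y, z, hx1, by linarith, by linarith, hz2, hv x (by linarith) hx,
      hv y (by linarith) hy, hv z (by linarith) hz⟩

theorem eventually_diagonalizable_evenBlock :
    ∀ᶠ s in 𝓝 (0 : ℝ × ℝ), 0 ≤ s.1 → Diagonalizable (evenBlock s.1 s.2).mulVecLin := by
  have hc : ∀ l, Continuous fun s : ℝ × ℝ => evenChar s.1 s.2 l := by
    intro l
    unfold evenChar evenReduced heatRatio
    simp only [Matrix.det_fin_two_of]
    fun_prop
  have hcs : ∀ z, Continuous fun s : ℝ × ℝ => evenCharScaled s.1 s.2 z := by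
    intro l; unfold evenCharScaled evenCorner heatRatioScaled; fun_prop
  -- At `a = b = 0` the nonzero roots are `l² = 7/5` and `5 l⁴ - 26 l² + 15 = 0`, that is, about
  -- `±0.81`, `±1.18`, `±2.13`; the points `1/2, 1, 3/2, 3` separate their absolute values. With `a
  -- < 1/2` the small eigenvalues stay inside `(-1/2, 1/2)`.
  filter_upwards [
    eventually_neg_of_neg (hc (-3)) (by norm_num [evenChar, evenReduced, heatRatio]),
    eventually_pos_of_pos (hc (-(3 / 2))) (by norm_num [evenChar, evenReduced, heatRatio]),
    eventually_neg_of_neg (hc (-1)) (by norm_num [evenChar, evenReduced, heatRatio]),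
    eventually_pos_of_pos (hc (-(1 / 2))) (by norm_num [evenChar, evenReduced, heatRatio]),
    eventually_neg_of_neg (hc (1 / 2)) (by norm_num [evenChar, evenReduced, heatRatio]),
    eventually_pos_of_pos (hc 1) (by norm_num [evenChar, evenReduced, heatRatio]),
    eventually_neg_of_neg (hc (3 / 2)) (by norm_num [evenChar, evenReduced, heatRatio]),
    eventually_pos_of_pos (hc 3) (by norm_num [evenChar, evenReduced, heatRatio]),
    eventually_pos_of_pos (hcs (-1))
      (by norm_num [evenCharScaled, evenCorner, heatRatioScaled]),
    eventually_neg_of_neg (hcs 0)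
      (by norm_num [evenCharScaled, evenCorner, heatRatioScaled]),
    eventually_neg_of_neg (hcs 1)
      (by norm_num [evenCharScaled, evenCorner, heatRatioScaled]),
    eventually_pos_of_pos (F := fun s : ℝ × ℝ => evenCorner s.1 s.2 0)
      (by unfold evenCorner heatRatioScaled; fun_prop)
      (by norm_num [evenCorner, heatRatioScaled]),
    eventually_neg_of_neg (F := fun s : ℝ × ℝ => s.1 - 1 / 2) (by fun_prop) (by norm_num)]
  rintro ⟨a, b⟩ h1 h2 h3 h4 h5 h6 h7 h8 h9 h10 h11 h12 h13 ha
  simp only at h1 h2 h3 h4 h5 h6 h7 h8 h9 h10 h11 h12 h13 ha ⊢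
  have hp := continuous_evenChar a b
  obtain ⟨l₁, l₁l, l₁r, hl₁⟩ := exists_root_of_neg_pos hp (by norm_num) h1 h2
  obtain ⟨l₂, l₂l, l₂r, hl₂⟩ := exists_root_of_pos_neg hp (by norm_num) h2 h3
  obtain ⟨l₃, l₃l, l₃r, hl₃⟩ := exists_root_of_neg_pos hp (by norm_num) h3 h4
  obtain ⟨l₄, l₄l, l₄r, hl₄⟩ := exists_root_of_neg_pos hp (by norm_num) h5 h6
  obtain ⟨l₅, l₅l, l₅r, hl₅⟩ := exists_root_of_pos_neg hp (by norm_num) h6 h7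
  obtain ⟨l₆, l₆l, l₆r, hl₆⟩ := exists_root_of_neg_pos hp (by norm_num) h7 h8
  replace hl₁ := evenBlock_exists_eigenvector (by linarith) hl₁
  replace hl₂ := evenBlock_exists_eigenvector (by linarith) hl₂
  replace hl₃ := evenBlock_exists_eigenvector (by linarith) hl₃
  replace hl₄ := evenBlock_exists_eigenvector (by linarith) hl₄
  replace hl₅ := evenBlock_exists_eigenvector (by linarith) hl₅
  replace hl₆ := evenBlock_exists_eigenvector (by linarith) hl₆
  rcases ha.eq_or_lt with rfl | ha
  · refine Diagonalizable.of_injective_of_kernel (m := 6) (n := 3)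
      (l := ![l₁, l₂, l₃, l₄, l₅, l₆])
      (k := ![![0, 0, 0, 0, 1, -1, 0, 0, 0], ![0, 0, 2, 0, -(8 / 5 * b), 0, 0, 0, -5],
        ![1, 0, 0, -1, 3, 0, 0, 0, b]]) (by simp) ?_ ?_ ?_ ?_ ?_
    · refine (Fin.strictMono_iff_lt_succ.2 ?_).injective
      intro i; fin_cases i <;> simp <;> linarith
    · intro i; fin_cases i <;> simp <;> intro h <;> linarith
    · intro i; fin_cases i; exacts [hl₁, hl₂, hl₃, hl₄, hl₅, hl₆]
    -- Each of the coordinates `ρ`, `u₂`, `θ₃₃` is nonzero on exactly one of the three kernel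
    -- vectors.
    · rw [Fintype.linearIndependent_iff]
      intro g hg
      have e0 := congrFun hg 0
      have e2 := congrFun hg 2
      have e5 := congrFun hg 5
      simp [Fin.sum_univ_three] at e0 e2 e5
      intro i; fin_cases i; exacts [e5, e2, e0]
    · intro i
      fin_cases i <;> ext j <;> fin_cases j <;>
        simp [evenBlock, Matrix.mulVec, dotProduct, Fin.sum_univ_succ]
      all_goals ring
  · obtain ⟨x, y, z, hx1, hxy, hyz, hz1, hx, hy, hz⟩ :=
      evenBlock_exists_small_eigenvalues ha (by linarith) h9 h10 h12 h11
    refine Diagonalizable.of_injective (n := 9)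
      (l := ![l₁, l₂, l₃, a * x, a * y, a * z, l₄, l₅, l₆]) (by simp) ?_ ?_
    · refine (Fin.strictMono_iff_lt_succ.2 ?_).injective
      have e1 : -(1 / 2) < a * x := by nlinarith
      have e2 : a * x < a * y := mul_lt_mul_of_pos_left hxy ha
      have e3 : a * y < a * z := mul_lt_mul_of_pos_left hyz ha
      have e4 : a * z < 1 / 2 := by nlinarith
      clear * - l₁l l₁r l₂l l₂r l₃l l₃r l₄l l₄r l₅l l₅r l₆l l₆r e1 e2 e3 e4
      intro i; fin_cases i <;> simp <;> linarith
    · intro i; fin_cases i; exacts [hl₁, hl₂, hl₃, hx, hy, hz, hl₄, hl₅, hl₆]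

/-! ### Parity splitting at the normal state -/

/-- The state `ρ = 1`, `u = 0`, `Θ = 1`, `s = (a, b, 0)`. -/
def normalState (a b : ℝ) : Fin 13 → ℝ := ![1, 0, 0, 0, 1, 1, 1, 0, 0, 0, a, b, 0]

theorem temp_normalState (a b : ℝ) : temp (normalState a b) = 1 := by
  ext i j; fin_cases i <;> fin_cases j <;> rfl

/-- The state with components `(ρ, u₁, u₂, θ₁₁, θ₂₂, θ₃₃, θ₁₂, s₁, s₂)`, the others being zero. -/
def evenEmbed : (Fin 9 → ℝ) →ₗ[ℝ] (Fin 13 → ℝ) where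
  toFun x := ![x 0, x 1, x 2, 0, x 3, x 4, x 5, x 6, 0, 0, x 7, x 8, 0]
  map_add' x y := by ext i; fin_cases i <;> simp
  map_smul' c x := by ext i; fin_cases i <;> simp

/-- The state with components `(u₃, θ₁₃, θ₂₃, s₃)`, the others being zero. -/
def oddEmbed : (Fin 4 → ℝ) →ₗ[ℝ] (Fin 13 → ℝ) where
  toFun x := ![0, 0, 0, x 0, 0, 0, 0, 0, x 1, x 2, 0, 0, x 3]
  map_add' x y := by ext i; fin_cases i <;> simp
  map_smul' c x := by ext i; fin_cases i <;> simp

theorem ext_components {x y : Fin 13 → ℝ} (h1 : rho x = rho y) (h2 : ∀ i, vel x i = vel y i)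
    (h3 : ∀ i j, temp x i j = temp y i j) (h4 : ∀ i, heat x i = heat y i) : x = y := by
  ext i
  fin_cases i
  exacts [h1, h2 0, h2 1, h2 2, h3 0 0, h3 1 1, h3 2 2, h3 0 1, h3 0 2, h3 1 2, h4 0, h4 1, h4 2]

theorem temp_symm (v : Fin 13 → ℝ) (i j : Fin 3) : temp v i j = temp v j i := by
  fin_cases i <;> fin_cases j <;> rfl

theorem sym3_swap (T : Fin 3 → Fin 3 → Fin 3 → ℝ) (i j k : Fin 3) :
    sym3 T i j k = sym3 T j i k := by
  simp only [sym3]; ring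

theorem tempTerms_symm (l : Fin 3) (w v : Fin 13 → ℝ) (i j : Fin 3) :
    tempTerms l w v i j = tempTerms l w v j i := by
  simp only [tempTerms, dThird, sym3_swap _ i j, temp_symm v i j, sym2]
  ring

theorem rho_spatialTerms (l : Fin 3) (w v : Fin 13 → ℝ) :
    rho (spatialTerms l w v) = rhoTerms l w v := rfl

theorem vel_spatialTerms (l : Fin 3) (w v : Fin 13 → ℝ) (i : Fin 3) :
    vel (spatialTerms l w v) i = velTerms l w v i := by
  fin_cases i <;> rfl

theorem temp_spatialTerms (l : Fin 3) (w v : Fin 13 → ℝ) (i j : Fin 3) :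
    temp (spatialTerms l w v) i j = tempTerms l w v i j := by
  fin_cases i <;> fin_cases j <;> first | rfl | exact tempTerms_symm _ _ _ _ _

theorem heat_spatialTerms (l : Fin 3) (w v : Fin 13 → ℝ) (i : Fin 3) :
    heat (spatialTerms l w v) i = heatTerms l w v i := by
  fin_cases i <;> rfl

theorem heatTerms_normalState (a b : ℝ) (v : Fin 13 → ℝ) (j : Fin 3) :
    heatTerms 0 (normalState a b) v j =
      -(6 / 5) * ∑ i, sym3 (fun p q r => (1 : Matrix (Fin 3) (Fin 3) ℝ) 0 p *
        heat (normalState a b) q * vel v r) i j i -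
      18 / 25 * ∑ i, sym3 (fun p q r => heat (normalState a b) p *
        dThird (normalState a b) v q r 0) i j i +
      1 / 2 * ((1 : Matrix (Fin 3) (Fin 3) ℝ) j 0 * (∑ i, temp v i i) + 2 * temp v j 0) +
      2 / 5 * (7 * sym2 (fun p q => heat (normalState a b) p * vel v q) j 0 +
        (1 : Matrix (Fin 3) (Fin 3) ℝ) j 0 * ∑ i, heat (normalState a b) i * vel v i) := by
  have h1 : rho (normalState a b) = 1 := rfl
  have h2 : vel (normalState a b) 0 = 0 := rfl
  have h3 : ∀ T : Fin 3 → Fin 3 → ℝ,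
      ∑ i, ∑ k, (1 : Matrix (Fin 3) (Fin 3) ℝ) i k * T i k = ∑ i, T i i := by
    intro T; simp [Matrix.one_apply]
  simp only [heatTerms, temp_normalState, inv_one, h1, h2, mul_assoc, h3, one_mul]
  simp only [sym2, Fin.sum_univ_three]
  ring

/-- The normal state is invariant under `x₃ ↦ -x₃` because `s₃ = 0`, so the components even under
this reflection form an invariant subspace; `spatialTerms_oddEmbed` is the odd counterpart. -/
theorem spatialTerms_evenEmbed (a b : ℝ) (x : Fin 9 → ℝ) :
    spatialTerms 0 (normalState a b) (evenEmbed x) = evenEmbed (evenBlock a b *ᵥ x) := by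
  obtain ⟨y, hy⟩ : ∃ y, y = evenBlock a b *ᵥ x := ⟨_, rfl⟩
  have hr : rho (normalState a b) = 1 := rfl
  have hu : vel (normalState a b) = ![0, 0, 0] := rfl
  have hs : heat (normalState a b) = ![a, b, 0] := rfl
  have hxr : ∀ x, rho (evenEmbed x) = x 0 := fun _ => rfl
  have hxu : ∀ x, vel (evenEmbed x) = ![x 1, x 2, 0] := fun _ => rfl
  have hxt : ∀ x, temp (evenEmbed x) = !![x 3, x 6, 0; x 6, x 4, 0; 0, 0, x 5] := fun _ => rfl
  have hxs : ∀ x, heat (evenEmbed x) = ![x 7, x 8, 0] := fun _ => rfl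
  rw [← hy]
  apply ext_components
  · rw [rho_spatialTerms, hxr]
    simp [rhoTerms, hy, evenBlock, dotProduct, Fin.sum_univ_succ, hr, hu, hxr, hxu]
  · intro i
    rw [vel_spatialTerms, hxu, velTerms, temp_normalState, hr, hu, hxr, hxu, hxt, hy]
    fin_cases i <;>
      simp [Matrix.one_fin_three, evenBlock, dotProduct, Fin.sum_univ_succ]
  · intro i j
    rw [temp_spatialTerms, hxt, tempTerms, temp_normalState, hr, hu, hxu, hxt, dThird,
      temp_normalState, hs, hxt, hxs, hy]
    fin_cases i <;> fin_cases j <;>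
      simp [Matrix.one_fin_three, evenBlock, dotProduct, Fin.sum_univ_succ, sym2, sym3]
    all_goals ring
  · intro i
    rw [heat_spatialTerms, heatTerms_normalState, hxs]
    simp only [dThird, temp_normalState, hs, hxt, hxs, hxu, hy, Fin.sum_univ_three, sym2, sym3]
    fin_cases i <;>
      simp [Matrix.one_fin_three, evenBlock, dotProduct, Fin.sum_univ_succ]
    all_goals ring

theorem spatialTerms_oddEmbed (a b : ℝ) (x : Fin 4 → ℝ) :
    spatialTerms 0 (normalState a b) (oddEmbed x) = oddEmbed (oddBlock a b *ᵥ x) := by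
  obtain ⟨y, hy⟩ : ∃ y, y = oddBlock a b *ᵥ x := ⟨_, rfl⟩
  have hr : rho (normalState a b) = 1 := rfl
  have hu : vel (normalState a b) = ![0, 0, 0] := rfl
  have hs : heat (normalState a b) = ![a, b, 0] := rfl
  have hxr : ∀ x, rho (oddEmbed x) = 0 := fun _ => rfl
  have hxu : ∀ x, vel (oddEmbed x) = ![0, 0, x 0] := fun _ => rfl
  have hxt : ∀ x, temp (oddEmbed x) = !![0, 0, x 1; 0, 0, x 2; x 1, x 2, 0] := fun _ => rfl
  have hxs : ∀ x, heat (oddEmbed x) = ![0, 0, x 3] := fun _ => rfl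
  rw [← hy]
  apply ext_components
  · rw [rho_spatialTerms, hxr]
    simp [rhoTerms, hr, hu, hxu]
  · intro i
    rw [vel_spatialTerms, hxu, velTerms, temp_normalState, hr, hu, hxr, hxu, hxt, hy]
    fin_cases i <;>
      simp [Matrix.one_fin_three, oddBlock, dotProduct, Fin.sum_univ_succ]
  · intro i j
    rw [temp_spatialTerms, hxt, tempTerms, temp_normalState, hr, hu, hxu, hxt, dThird,
      temp_normalState, hs, hxt, hxs, hy]
    fin_cases i <;> fin_cases j <;>
      simp [Matrix.one_fin_three, oddBlock, dotProduct, Fin.sum_univ_succ, sym2, sym3]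
    all_goals ring
  · intro i
    rw [heat_spatialTerms, heatTerms_normalState, hxs]
    simp only [dThird, temp_normalState, hs, hxt, hxs, hxu, hy, Fin.sum_univ_three, sym2, sym3]
    fin_cases i <;>
      simp [Matrix.one_fin_three, oddBlock, dotProduct, Fin.sum_univ_succ]
    all_goals ring

theorem diagonalizable_normalState {a b : ℝ} (he : Diagonalizable (evenBlock a b).mulVecLin)
    (ho : Diagonalizable (oddBlock a b).mulVecLin) :
    Diagonalizable (coeffMatrix 0 (normalState a b)).mulVecLin := by
  refine he.of_coprod ho evenEmbed oddEmbed ?_ ?_ ?_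
  · intro v
    rw [Matrix.mulVecLin_apply, ← spatialTerms_eq_mulVec, spatialTerms_evenEmbed]; rfl
  · intro v
    rw [Matrix.mulVecLin_apply, ← spatialTerms_eq_mulVec, spatialTerms_oddEmbed]; rfl
  · intro x
    refine ⟨![x 0, x 1, x 2, x 4, x 5, x 6, x 7, x 10, x 11], ![x 3, x 8, x 9, x 12], ?_⟩
    ext i; fin_cases i <;> simp [evenEmbed, oddEmbed]

/-! ### Tensors under a change of frame -/

section Tensor

variable (L : Matrix (Fin 3) (Fin 3) ℝ)

/-- The change of frame `L` applied to a 2-tensor. -/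
def push2 (T : Fin 3 → Fin 3 → ℝ) (i j : Fin 3) : ℝ := ∑ p, ∑ q, L i p * L j q * T p q

/-- The change of frame `L` applied to a 3-tensor. -/
def push3 (T : Fin 3 → Fin 3 → Fin 3 → ℝ) (i j k : Fin 3) : ℝ :=
  ∑ p, ∑ q, ∑ r, L i p * L j q * L k r * T p q r

theorem sym2_push2 (T : Fin 3 → Fin 3 → ℝ) : sym2 (push2 L T) = push2 L (sym2 T) := by
  ext i j
  simp only [sym2, push2, Fin.sum_univ_three]; ring

theorem sym3_push3 (T : Fin 3 → Fin 3 → Fin 3 → ℝ) : sym3 (push3 L T) = push3 L (sym3 T) := by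
  ext i j k
  simp only [sym3, push3, Fin.sum_univ_three]; ring

theorem sym2_mul (c : ℝ) (T : Fin 3 → Fin 3 → ℝ) (i j : Fin 3) :
    sym2 (fun a b => c * T a b) i j = c * sym2 T i j := by
  simp only [sym2]; ring

theorem sym3_mul (c : ℝ) (T : Fin 3 → Fin 3 → Fin 3 → ℝ) (i j k : Fin 3) :
    sym3 (fun a b d => c * T a b d) i j k = c * sym3 T i j k := by
  simp only [sym3]; ring

/-- Since the first row of `L` is a multiple of `e₁`, a tensor index in the `x₁` direction stays
there and only contributes the factor `L 0 0`. -/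
theorem push3_last {L : Matrix (Fin 3) (Fin 3) ℝ} (h1 : L 0 1 = 0) (h2 : L 0 2 = 0)
    (T : Fin 3 → Fin 3 → Fin 3 → ℝ) (i j : Fin 3) :
    push3 L T i j 0 = L 0 0 * push2 L (fun p q => T p q 0) i j := by
  simp only [push3, push2, Fin.sum_univ_three, h1, h2]; ring

variable {L} {G : Matrix (Fin 3) (Fin 3) ℝ}

/-- In the new frame `G` becomes the identity, so contraction with `Θ⁻¹` becomes a plain trace. -/
theorem sum_mul_push2 (hG : Lᵀ * G * L = 1) (T : Fin 3 → Fin 3 → ℝ) :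
    ∑ i, ∑ k, G i k * push2 L T i k = ∑ p, T p p := by
  have h : ∑ i, ∑ k, G i k * push2 L T i k = ∑ p, ∑ q, (Lᵀ * G * L) p q * T p q := by
    simp only [push2, Matrix.mul_apply, Matrix.transpose_apply, Fin.sum_univ_three]; ring
  rw [h, hG]
  simp [Matrix.one_apply]

theorem sum_mul_push3 (hG : Lᵀ * G * L = 1) (T : Fin 3 → Fin 3 → Fin 3 → ℝ) (j : Fin 3) :
    ∑ i, ∑ k, G i k * push3 L T i j k = ∑ q, L j q * ∑ p, T p q p := by
  have h : ∑ i, ∑ k, G i k * push3 L T i j k =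
      ∑ q, L j q * ∑ p, ∑ r, (Lᵀ * G * L) p r * T p q r := by
    simp only [push3, Matrix.mul_apply, Matrix.transpose_apply, Fin.sum_univ_three]; ring
  rw [h, hG]
  simp [Matrix.one_apply]

end Tensor

theorem rho_add (x y : Fin 13 → ℝ) : rho (x + y) = rho x + rho y := rfl

theorem rho_smul (c : ℝ) (x : Fin 13 → ℝ) : rho (c • x) = c * rho x := rfl

theorem vel_add (x y : Fin 13 → ℝ) (i : Fin 3) : vel (x + y) i = vel x i + vel y i := by
  fin_cases i <;> rfl

theorem vel_smul (c : ℝ) (x : Fin 13 → ℝ) (i : Fin 3) : vel (c • x) i = c * vel x i := by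
  fin_cases i <;> rfl

theorem temp_add (x y : Fin 13 → ℝ) (i j : Fin 3) : temp (x + y) i j = temp x i j + temp y i j := by
  fin_cases i <;> fin_cases j <;> rfl

theorem temp_smul (c : ℝ) (x : Fin 13 → ℝ) (i j : Fin 3) : temp (c • x) i j = c * temp x i j := by
  fin_cases i <;> fin_cases j <;> rfl

theorem heat_add (x y : Fin 13 → ℝ) (i : Fin 3) : heat (x + y) i = heat x i + heat y i := by
  fin_cases i <;> rfl

theorem heat_smul (c : ℝ) (x : Fin 13 → ℝ) (i : Fin 3) : heat (c • x) i = c * heat x i := by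
  fin_cases i <;> rfl

/-- The change of frame `(ρ, u, θ, s) ↦ (r ρ, L u, L θ Lᵀ, r L s)` on states. -/
def frameFun (r : ℝ) (L : Matrix (Fin 3) (Fin 3) ℝ) (v : Fin 13 → ℝ) : Fin 13 → ℝ :=
  ![r * rho v, ∑ p, L 0 p * vel v p, ∑ p, L 1 p * vel v p, ∑ p, L 2 p * vel v p,
    push2 L (fun p q => temp v p q) 0 0, push2 L (fun p q => temp v p q) 1 1,
    push2 L (fun p q => temp v p q) 2 2, push2 L (fun p q => temp v p q) 0 1,
    push2 L (fun p q => temp v p q) 0 2, push2 L (fun p q => temp v p q) 1 2,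
    r * ∑ p, L 0 p * heat v p, r * ∑ p, L 1 p * heat v p, r * ∑ p, L 2 p * heat v p]

section ChangeFrame

variable (r : ℝ) (L : Matrix (Fin 3) (Fin 3) ℝ) (v : Fin 13 → ℝ)

theorem rho_frameFun : rho (frameFun r L v) = r * rho v := rfl

theorem vel_frameFun (i : Fin 3) : vel (frameFun r L v) i = ∑ p, L i p * vel v p := by
  fin_cases i <;> rfl

theorem temp_frameFun (i j : Fin 3) :
    temp (frameFun r L v) i j = push2 L (fun p q => temp v p q) i j := by
  have h : ∀ i j, push2 L (fun p q => temp v p q) i j = push2 L (fun p q => temp v p q) j i := by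
    intro i j
    simp only [push2, Fin.sum_univ_three, temp_symm v 1 0, temp_symm v 2 0, temp_symm v 2 1]
    ring
  fin_cases i <;> fin_cases j <;> first | rfl | exact h _ _

theorem heat_frameFun (i : Fin 3) :
    heat (frameFun r L v) i = r * ∑ p, L i p * heat v p := by
  fin_cases i <;> rfl

/-- The change of frame `(ρ, u, θ, s) ↦ (r ρ, L u, L θ Lᵀ, r L s)` as a linear map. -/
def changeFrame : (Fin 13 → ℝ) →ₗ[ℝ] (Fin 13 → ℝ) where
  toFun := frameFun r L
  map_add' x y := by
    apply ext_components <;> intros <;>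
      simp only [rho_frameFun, vel_frameFun, temp_frameFun, heat_frameFun, rho_add, vel_add,
        temp_add, heat_add, push2, Fin.sum_univ_three] <;> ring
  map_smul' c x := by
    apply ext_components <;> intros <;>
      simp only [rho_frameFun, vel_frameFun, temp_frameFun, heat_frameFun, rho_smul, vel_smul,
        temp_smul, heat_smul, push2, Fin.sum_univ_three, RingHom.id_apply] <;> ring

theorem rho_changeFrame : rho (changeFrame r L v) = r * rho v := rfl

theorem vel_changeFrame (i : Fin 3) : vel (changeFrame r L v) i = ∑ p, L i p * vel v p :=
  vel_frameFun r L v i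

theorem temp_changeFrame (i j : Fin 3) :
    temp (changeFrame r L v) i j = push2 L (fun p q => temp v p q) i j :=
  temp_frameFun r L v i j

theorem heat_changeFrame (i : Fin 3) :
    heat (changeFrame r L v) i = r * ∑ p, L i p * heat v p :=
  heat_frameFun r L v i

theorem changeFrame_surjective {r : ℝ} (hr : r ≠ 0) {L M : Matrix (Fin 3) (Fin 3) ℝ}
    (hL : L * M = 1) : Function.Surjective (changeFrame r L) := by
  intro x
  have key : ∀ (f : Fin 3 → ℝ) i, ∑ p, L i p * ∑ q, M p q * f q = f i := by
    intro f i
    have : ∑ p, L i p * ∑ q, M p q * f q = ∑ q, (L * M) i q * f q := by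
      simp only [Matrix.mul_apply, Fin.sum_univ_three]; ring
    rw [this, hL]; simp [Matrix.one_apply]
  refine ⟨changeFrame r⁻¹ M x, ext_components ?_ ?_ ?_ ?_⟩
  · rw [rho_changeFrame, rho_changeFrame, mul_inv_cancel_left₀ hr]
  · intro i; simp only [vel_changeFrame, key]
  · intro i j
    have : push2 L (push2 M fun p q => temp x p q) i j =
        ∑ p, L i p * ∑ q, M p q * ∑ p', L j p' * ∑ q', M p' q' * temp x q q' := by
      simp only [push2, Fin.sum_univ_three]; ring
    simp only [temp_changeFrame]
    rw [this]
    simp only [key]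
  · intro i
    simp only [heat_changeFrame]
    rw [show ∑ p, L i p * (r⁻¹ * ∑ q, M p q * heat x q) =
      r⁻¹ * ∑ p, L i p * ∑ q, M p q * heat x q by simp only [Fin.sum_univ_three]; ring, key,
      mul_inv_cancel_left₀ hr]

end ChangeFrame

theorem push2_last {L : Matrix (Fin 3) (Fin 3) ℝ} (h1 : L 0 1 = 0) (h2 : L 0 2 = 0)
    (T : Fin 3 → Fin 3 → ℝ) (i : Fin 3) :
    push2 L T i 0 = L 0 0 * ∑ p, L i p * T p 0 := by
  simp only [push2, Fin.sum_univ_three, h1, h2]; ring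

theorem push2_mul (L : Matrix (Fin 3) (Fin 3) ℝ) (c : ℝ) (T : Fin 3 → Fin 3 → ℝ) (i j : Fin 3) :
    push2 L (fun p q => c * T p q) i j = c * push2 L T i j := by
  simp only [push2, Fin.sum_univ_three]; ring

theorem push2_add (L : Matrix (Fin 3) (Fin 3) ℝ) (S T : Fin 3 → Fin 3 → ℝ) (i j : Fin 3) :
    push2 L (fun p q => S p q + T p q) i j = push2 L S i j + push2 L T i j := by
  simp only [push2, Fin.sum_univ_three]; ring

theorem push3_add (L : Matrix (Fin 3) (Fin 3) ℝ) (S T : Fin 3 → Fin 3 → Fin 3 → ℝ)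
    (i j k : Fin 3) :
    push3 L (fun p q s => S p q s + T p q s) i j k = push3 L S i j k + push3 L T i j k := by
  simp only [push3, Fin.sum_univ_three]; ring

theorem sum_mul_sum_eq_push2 (L : Matrix (Fin 3) (Fin 3) ℝ) (x y : Fin 3 → ℝ) (i j : Fin 3) :
    (∑ p, L i p * x p) * ∑ q, L j q * y q = push2 L (fun p q => x p * y q) i j := by
  simp only [push2, Fin.sum_univ_three]; ring

theorem sum_mul_push2_eq_push3 (L : Matrix (Fin 3) (Fin 3) ℝ) (x : Fin 3 → ℝ)
    (T : Fin 3 → Fin 3 → ℝ) (i j k : Fin 3) :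
    (∑ p, L i p * x p) * push2 L T j k = push3 L (fun p q s => x p * T q s) i j k := by
  simp only [push2, push3, Fin.sum_univ_three]; ring

theorem push2_mul_sum_eq_push3 (L : Matrix (Fin 3) (Fin 3) ℝ) (x : Fin 3 → ℝ)
    (T : Fin 3 → Fin 3 → ℝ) (i j k : Fin 3) :
    push2 L T i j * (∑ p, L k p * x p) = push3 L (fun p q s => T p q * x s) i j k := by
  simp only [push2, push3, Fin.sum_univ_three]; ring

theorem sum_sum_mul_left (G : Matrix (Fin 3) (Fin 3) ℝ) (c : ℝ) (T : Fin 3 → Fin 3 → ℝ) :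
    ∑ i, ∑ k, G i k * (c * T i k) = c * ∑ i, ∑ k, G i k * T i k := by
  simp only [Fin.sum_univ_three]; ring

/-! ### Equivariance of the system -/

section Intertwine

variable {r : ℝ} {L : Matrix (Fin 3) (Fin 3) ℝ} {w : Fin 13 → ℝ} {a b : ℝ}

theorem dThird_changeFrame (hT : temp w = L * Lᵀ)
    (hs : ∀ i, heat w i = r * ∑ p, L i p * heat (normalState a b) p)
    (v : Fin 13 → ℝ) (i j k : Fin 3) :
    dThird w (changeFrame r L v) i j k = r * push3 L (dThird (normalState a b) v) i j k := by
  have hT' : ∀ i j, temp w i j = push2 L (fun p q => temp (normalState a b) p q) i j := by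
    intro i j
    rw [hT, temp_normalState]
    simp [push2, Matrix.mul_apply, Matrix.one_apply]
  have e1 : (fun p q s => heat w p * temp (changeFrame r L v) q s) = fun p q s =>
      r * push3 L (fun p q s => heat (normalState a b) p * temp v q s) p q s := by
    ext p q s
    rw [hs, temp_changeFrame, mul_assoc, sum_mul_push2_eq_push3]
  have e2 : (fun p q s => temp w p q * heat (changeFrame r L v) s) = fun p q s =>
      r * push3 L (fun p q s => temp (normalState a b) p q * heat v s) p q s := by
    ext p q s
    rw [hT', heat_changeFrame, mul_left_comm, push2_mul_sum_eq_push3]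
  rw [dThird, e1, e2, sym3_mul, sym3_mul, sym3_push3, sym3_push3, ← mul_add, ← push3_add]
  rfl

/-- The change of frame intertwines the coefficient matrix of a state with that of the normal
state. -/
theorem spatialTerms_changeFrame (hr : r ≠ 0) (h1 : L 0 1 = 0) (h2 : L 0 2 = 0)
    (hG : Lᵀ * (temp w)⁻¹ * L = 1) (hT : temp w = L * Lᵀ) (hρ : rho w = r)
    (hs : ∀ i, heat w i = r * ∑ p, L i p * heat (normalState a b) p) (v : Fin 13 → ℝ) :
    spatialTerms 0 w (changeFrame r L v) =
      changeFrame r L (L 0 0 • spatialTerms 0 (normalState a b) v + vel w 0 • v) := by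
  have hT' : ∀ i j, temp w i j = ∑ p, L i p * L j p := by
    intro i j; rw [hT, Matrix.mul_apply]; rfl
  -- The first column of `Θ` is `L 0 0` times the first column of `L`; this is where the scaling
  -- factor of the conjugated matrix comes from.
  have hT0 : ∀ i, temp w i 0 = L 0 0 * L i 0 := by
    intro i; rw [hT', Fin.sum_univ_three, h1, h2]; ring
  have hT0' : ∀ i, temp w 0 i = L 0 0 * L i 0 := by
    intro i; rw [hT', Fin.sum_univ_three, h1, h2]; ring
  have h0 : rho (normalState a b) = 1 := rfl
  have h0' : vel (normalState a b) 0 = 0 := rfl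
  have h10 : ∀ i : Fin 3, ∑ p, L i p * (1 : Matrix (Fin 3) (Fin 3) ℝ) 0 p = L i 0 := by
    intro i; simp [Matrix.one_apply]
  have h10' : ∀ i : Fin 3, ∑ p, L i p * (1 : Matrix (Fin 3) (Fin 3) ℝ) p 0 = L i 0 := by
    intro i; simp [Matrix.one_apply]
  have hD : ∀ i j, dThird w (changeFrame r L v) i j 0 =
      r * L 0 0 * push2 L (fun p q => dThird (normalState a b) v p q 0) i j := by
    intro i j
    rw [dThird_changeFrame hT hs, push3_last h1 h2, mul_assoc]
  apply ext_components
  · rw [rho_spatialTerms, rho_changeFrame, rho_add, rho_smul, rho_smul, rho_spatialTerms,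
      rhoTerms, rhoTerms, h0, h0', hρ, rho_changeFrame, vel_changeFrame, Fin.sum_univ_three, h1,
      h2]
    ring
  · intro i
    rw [vel_spatialTerms, vel_changeFrame, velTerms, hT0, hρ, rho_changeFrame, vel_changeFrame,
      temp_changeFrame, push2_last h1 h2]
    simp only [vel_add, vel_smul, vel_spatialTerms, velTerms, h0, h0', temp_normalState]
    rw [← h10' i]
    simp only [Fin.sum_univ_three]
    field_simp
    ring
  · intro i j
    have e : (fun p q => temp w 0 p * vel (changeFrame r L v) q) = fun p q => L 0 0 *
        push2 L (fun p q => (1 : Matrix (Fin 3) (Fin 3) ℝ) 0 p * vel v q) p q := by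
      ext p q
      rw [hT0', vel_changeFrame, ← sum_mul_sum_eq_push2, h10, mul_assoc]
    have e' : (fun p q => temp (L 0 0 • spatialTerms 0 (normalState a b) v + vel w 0 • v) p q) =
        fun p q =>
        (L 0 0 * 2 * sym2 (fun p q => (1 : Matrix (Fin 3) (Fin 3) ℝ) 0 p * vel v q) p q +
          L 0 0 * (6 / 5) * dThird (normalState a b) v p q 0) + vel w 0 * temp v p q := by
      ext p q
      rw [temp_add, temp_smul, temp_smul, temp_spatialTerms, tempTerms, h0, h0', temp_normalState]
      ring
    rw [temp_spatialTerms, temp_changeFrame, tempTerms, hD, hρ, temp_changeFrame, e, e', sym2_mul,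
      sym2_push2, push2_add, push2_add, push2_mul, push2_mul,
      push2_mul L _ (fun p q => temp v p q)]
    field_simp
    ring
  · intro j
    have eA : (fun p q s => temp w 0 p * heat w q * vel (changeFrame r L v) s) = fun p q s =>
        r * L 0 0 * push3 L (fun p q s => (1 : Matrix (Fin 3) (Fin 3) ℝ) 0 p *
          heat (normalState a b) q * vel v s) p q s := by
      ext p q s
      rw [hT0', hs, vel_changeFrame, ← push2_mul_sum_eq_push3 L _
        (fun p q => (1 : Matrix (Fin 3) (Fin 3) ℝ) 0 p * heat (normalState a b) q),
        ← sum_mul_sum_eq_push2, h10]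
      ring
    have eB : (fun p q s => heat w p * dThird w (changeFrame r L v) q s 0) = fun p q s =>
        r * r * L 0 0 * push3 L (fun p q s => heat (normalState a b) p *
          dThird (normalState a b) v q s 0) p q s := by
      ext p q s
      rw [hs, hD, ← sum_mul_push2_eq_push3 L _ (fun q s => dThird (normalState a b) v q s 0)]
      ring
    have eC : ∑ i, ∑ k, r * (temp w)⁻¹ i k * temp w j 0 * temp (changeFrame r L v) i k =
        r * (L 0 0 * L j 0) * ∑ p, temp v p p := by
      rw [← sum_mul_push2 hG (fun p q => temp v p q), ← sum_sum_mul_left]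
      refine Finset.sum_congr rfl fun i _ => Finset.sum_congr rfl fun k _ => ?_
      rw [hT0, temp_changeFrame]; ring
    have eD : (fun p q => heat w p * vel (changeFrame r L v) q) = fun p q =>
        r * push2 L (fun p q => heat (normalState a b) p * vel v q) p q := by
      ext p q
      rw [hs, vel_changeFrame, mul_assoc, sum_mul_sum_eq_push2]
    have eE : ∑ i, ∑ k, (temp w)⁻¹ i k * temp w j 0 *
        sym2 (fun p q => heat w p * vel (changeFrame r L v) q) i k =
        r * (L 0 0 * L j 0) * ∑ p, heat (normalState a b) p * vel v p := by
      have : ∀ p, heat (normalState a b) p * vel v p =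
          sym2 (fun p q => heat (normalState a b) p * vel v q) p p := by
        intro p; simp only [sym2]; ring
      simp only [this]
      rw [← sum_mul_push2 hG, ← sum_sum_mul_left, eD]
      refine Finset.sum_congr rfl fun i _ => Finset.sum_congr rfl fun k _ => ?_
      rw [hT0, sym2_mul, sym2_push2]; ring
    rw [heat_spatialTerms, heat_changeFrame, heatTerms, hρ, eA, eB, eC, eE, eD, heat_changeFrame,
      temp_changeFrame]
    simp only [sym3_mul, sym3_push3, sum_sum_mul_left, sum_mul_push3 hG, sym2_mul, sym2_push2,
      push2_last h1 h2, heat_add, heat_smul, heat_spatialTerms, heatTerms_normalState]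
    rw [← h10' j]
    simp only [Fin.sum_univ_three]
    field_simp
    ring

end Intertwine

/-! ### The adapted frame -/

/-- Normalization leaves a sign free; it is spent on making `a ≥ 0`. -/
theorem exists_smul_dotProduct_self_eq_one {g : Fin 3 → ℝ} (hg : g ≠ 0) (t : Fin 3 → ℝ) :
    ∃ c : ℝ, (c • g) ⬝ᵥ (c • g) = 1 ∧ 0 ≤ (c • g) ⬝ᵥ t := by
  have h0 : 0 < g ⬝ᵥ g := by
    refine lt_of_le_of_ne ?_ (Ne.symm (mt dotProduct_self_eq_zero.1 hg))
    exact Finset.sum_nonneg fun i _ => mul_self_nonneg _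
  obtain ⟨d, hd⟩ : ∃ d : ℝ, d * d * (g ⬝ᵥ g) = 1 := by
    refine ⟨(√(g ⬝ᵥ g))⁻¹, ?_⟩
    rw [← mul_inv, Real.mul_self_sqrt h0.le, inv_mul_cancel₀ h0.ne']
  rcases le_total 0 (d * (g ⬝ᵥ t)) with h | h
  · exact ⟨d, by simpa [mul_assoc] using hd, by simpa using h⟩
  · exact ⟨-d, by simpa [mul_assoc] using hd, by simpa using h⟩

/-- A matrix with a zero row is singular. Unlike a cross product, this also covers parallel `g` and
`t`. -/
theorem exists_ne_zero_orthogonal (g t : Fin 3 → ℝ) :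
    ∃ n : Fin 3 → ℝ, n ≠ 0 ∧ g ⬝ᵥ n = 0 ∧ t ⬝ᵥ n = 0 := by
  have hdet : (Matrix.of ![g, t, 0]).det = 0 :=
    Matrix.det_eq_zero_of_row_eq_zero 2 fun j => rfl
  obtain ⟨n, hn, h⟩ := Matrix.exists_mulVec_eq_zero_iff.2 hdet
  exact ⟨n, hn, congrFun h 0, congrFun h 1⟩

/-- An orthogonal matrix moving `g` to the first axis and `t` to the span of the first two. -/
theorem exists_orthogonal {g : Fin 3 → ℝ} (hg : g ≠ 0) (t : Fin 3 → ℝ) :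
    ∃ R : Matrix (Fin 3) (Fin 3) ℝ, R * Rᵀ = 1 ∧ (R *ᵥ g) 1 = 0 ∧ (R *ᵥ g) 2 = 0 ∧
      0 ≤ (R *ᵥ t) 0 ∧ (R *ᵥ t) 2 = 0 := by
  obtain ⟨n, hn, hgn, htn⟩ := exists_ne_zero_orthogonal g t
  obtain ⟨c, hc, hct⟩ := exists_smul_dotProduct_self_eq_one hg t
  obtain ⟨d, hd, -⟩ := exists_smul_dotProduct_self_eq_one hn t
  simp only [dotProduct, Fin.sum_univ_three, Pi.smul_apply, smul_eq_mul] at hgn htn hc hct hd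
  have hcd : c * g 0 * (d * n 0) + c * g 1 * (d * n 1) + c * g 2 * (d * n 2) = 0 := by
    linear_combination c * d * hgn
  -- The rows are the unit vector along `g`, the cross product of the third row with the first, and
  -- the unit normal to `g` and `t`.
  refine ⟨!![c * g 0, c * g 1, c * g 2;
    d * n 1 * (c * g 2) - d * n 2 * (c * g 1), d * n 2 * (c * g 0) - d * n 0 * (c * g 2),
      d * n 0 * (c * g 1) - d * n 1 * (c * g 0);
    d * n 0, d * n 1, d * n 2], ?_, ?_, ?_, ?_, ?_⟩
  · generalize c * g 0 = x0, c * g 1 = x1, c * g 2 = x2 at hc hcd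
    generalize d * n 0 = y0, d * n 1 = y1, d * n 2 = y2 at hd hcd
    ext i j
    fin_cases i <;> fin_cases j <;>
      simp [Matrix.mul_apply, Fin.sum_univ_three]
    · exact hc
    · ring
    · exact hcd
    · ring
    -- Lagrange's identity for the norm of a cross product.
    · linear_combination (y0 * y0 + y1 * y1 + y2 * y2) * hc + hd -
        (x0 * y0 + x1 * y1 + x2 * y2) * hcd
    · ring
    · linear_combination hcd
    · ring
    · exact hd
  · simp [Matrix.mulVec, dotProduct, Fin.sum_univ_three]; ring
  · simp [Matrix.mulVec, dotProduct, Fin.sum_univ_three]; linear_combination d * hgn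
  · simpa [Matrix.mulVec, dotProduct, Fin.sum_univ_three] using hct
  · simp [Matrix.mulVec, dotProduct, Fin.sum_univ_three]; linear_combination d * htn

open scoped MatrixOrder Matrix.Norms.L2Operator in
theorem exists_eq_mul_transpose {A : Matrix (Fin 3) (Fin 3) ℝ} (hA : A.PosDef) :
    ∃ C : Matrix (Fin 3) (Fin 3) ℝ, A = C * Cᵀ := by
  obtain ⟨B, hB⟩ := CStarAlgebra.nonneg_iff_eq_star_mul_self.mp hA.posSemidef.nonneg
  exact ⟨Bᵀ, by simpa [Matrix.star_eq_conjTranspose] using hB⟩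

/-- A frame adapted to the first axis and to `t` in which `A` is the identity. -/
theorem exists_frame {A : Matrix (Fin 3) (Fin 3) ℝ} (hA : A.PosDef) (t : Fin 3 → ℝ) :
    ∃ (L : Matrix (Fin 3) (Fin 3) ℝ) (a b : ℝ), A = L * Lᵀ ∧ L 0 1 = 0 ∧ L 0 2 = 0 ∧
      0 ≤ a ∧ t = L *ᵥ ![a, b, 0] := by
  obtain ⟨C, hC⟩ := exists_eq_mul_transpose hA
  have hCu : IsUnit C.det := by
    have h := hA.det_pos
    rw [hC, Matrix.det_mul] at h
    exact isUnit_iff_ne_zero.2 (left_ne_zero_of_mul h.ne')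
  have hg : C 0 ≠ 0 := by
    intro h0
    have h := hA.diag_pos (i := 0)
    rw [hC, Matrix.mul_apply] at h
    simp [h0] at h
  obtain ⟨R, hR, h1, h2, h3, h4⟩ := exists_orthogonal hg (C⁻¹ *ᵥ t)
  have hR' : Rᵀ * R = 1 := mul_eq_one_comm.1 hR
  have hrow : ∀ j, (C * Rᵀ) 0 j = (R *ᵥ C 0) j := by
    intro j
    simp [Matrix.mul_apply, Matrix.mulVec, dotProduct, mul_comm]
  -- Right multiplication by an orthogonal matrix preserves `C Cᵀ`. This freedom is used to send the
  -- first row of `C` to the first axis and `C⁻¹ t` to the span of the first two.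
  refine ⟨C * Rᵀ, (R *ᵥ C⁻¹ *ᵥ t) 0, (R *ᵥ C⁻¹ *ᵥ t) 1, ?_, ?_, ?_, h3, ?_⟩
  · rw [Matrix.transpose_mul, Matrix.transpose_transpose, Matrix.mul_assoc,
      ← Matrix.mul_assoc Rᵀ, hR', Matrix.one_mul, hC]
  · rw [hrow, h1]
  · rw [hrow, h2]
  · have : ![(R *ᵥ C⁻¹ *ᵥ t) 0, (R *ᵥ C⁻¹ *ᵥ t) 1, 0] = R *ᵥ C⁻¹ *ᵥ t := by
      ext i; fin_cases i <;> simp [h4]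
    rw [this, Matrix.mulVec_mulVec, Matrix.mulVec_mulVec, Matrix.mul_assoc C Rᵀ R,
      hR', Matrix.mul_one, Matrix.mul_nonsing_inv _ hCu, Matrix.one_mulVec]

end Moment13

end

/-! ### Conclusion -/

theorem theorem4p1 :
    ∃ δ : ℝ, 0 < δ ∧ ∀ w : Fin 13 → ℝ,
      0 < Moment13.rho w → (Moment13.temp w).PosDef →
      (Moment13.rho w ^ 2)⁻¹ *
          (Moment13.heat w ⬝ᵥ ((Moment13.temp w)⁻¹ *ᵥ Moment13.heat w)) < δ →
      Moment13.RealDiagonalizable (Moment13.coeffMatrix 0 w) := by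
  obtain ⟨ε, hε, h⟩ := Metric.eventually_nhds_iff.1
    (Moment13.eventually_diagonalizable_evenBlock.and
      Moment13.eventually_diagonalizable_oddBlock)
  refine ⟨ε ^ 2, by positivity, fun w hρ hT hs => ?_⟩
  obtain ⟨L, a, b, hL, h1, h2, ha, ht⟩ :=
    Moment13.exists_frame hT ((Moment13.rho w)⁻¹ • Moment13.heat w)
  have hTu : IsUnit (Moment13.temp w).det := isUnit_iff_ne_zero.2 hT.det_pos.ne'
  have hLi : L * (Lᵀ * (Moment13.temp w)⁻¹) = 1 := by
    rw [← Matrix.mul_assoc, ← hL, Matrix.mul_nonsing_inv _ hTu]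
  have hG : Lᵀ * (Moment13.temp w)⁻¹ * L = 1 := mul_eq_one_comm.1 hLi
  have hh : Moment13.heat w = Moment13.rho w • (L *ᵥ ![a, b, 0]) := by
    rw [← ht, smul_inv_smul₀ hρ.ne']
  -- In the adapted frame `Θ⁻¹` is the identity and `s / ρ` is `(a, b, 0)`, which is why `δ = ε ^ 2`
  -- works.
  have hs' : a ^ 2 + b ^ 2 < ε ^ 2 := by
    have e : L *ᵥ ![a, b, 0] ⬝ᵥ ((Moment13.temp w)⁻¹ *ᵥ L *ᵥ ![a, b, 0]) = a ^ 2 + b ^ 2 := by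
      rw [← Matrix.vecMul_transpose, ← Matrix.dotProduct_mulVec, Matrix.mulVec_mulVec,
        Matrix.vecMul_transpose, Matrix.mulVec_mulVec, hG, Matrix.one_mulVec]
      simp [dotProduct, Fin.sum_univ_three, sq]
    rw [hh, Matrix.mulVec_smul, smul_dotProduct, dotProduct_smul, e] at hs
    simp only [smul_eq_mul] at hs
    rwa [← mul_assoc (Moment13.rho w), ← sq, inv_mul_cancel_left₀ (by positivity)] at hs
  have hd : dist (a, b) (0 : ℝ × ℝ) < ε := by
    rw [dist_zero_right, Prod.norm_mk, max_lt_iff]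
    exact ⟨abs_lt_of_sq_lt_sq (by nlinarith) hε.le, abs_lt_of_sq_lt_sq (by nlinarith) hε.le⟩
  obtain ⟨he, ho⟩ := h hd
  refine Moment13.Diagonalizable.realDiagonalizable
    ((Moment13.diagonalizable_normalState (he ha) (ho ha)).of_surjective
      (Moment13.changeFrame (Moment13.rho w) L)
      (Moment13.changeFrame_surjective hρ.ne' hLi) (L 0 0) (Moment13.vel w 0) fun v => ?_)
  rw [Matrix.mulVecLin_apply, Matrix.mulVecLin_apply, ← Moment13.spatialTerms_eq_mulVec,
    ← Moment13.spatialTerms_eq_mulVec]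
  refine Moment13.spatialTerms_changeFrame hρ.ne' h1 h2 hG hL rfl (fun i => ?_) v
  rw [hh]
  rfl
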